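/- Let $k$ be an algebraically closed field, let $V$ be a scheme over $k$ (for instance an algebraic variety), and let $E_1,\dots,E_n$ be line bundles on $V$. Let $\mathbf Q=(Q,I)$ be a quiver with relations on the nodes $1,\dots,n$ (a directed graph $Q$ with an admissible ideal $I$, i.e. a two-sided homogeneous ideal of the path algebra $P(Q)$ contained in the square of the ideal spanned by paths of positive length), together with an isomorphism of $k$-algebras $P(Q)/I\cong \operatorname{End}_V(E_1\oplus\dots\oplus E_n)^{\mathrm{op}}$ matching the idempotents of the nodes with the projections to the summands, so that classes of paths from $j$ to $i$ correspond to $\operatorname{Hom}(E_i,E_j)$; for example, the Bondal quiver of a decent collection of $\mathbb G_m$-equivariant line bundles on a nearly projective variety, with such an isomorphism. For a $k$-point $p$ of $V$ (a closed point, if $V$ is a variety) with structure sheaf $\mathcal O_p$, the tautological representation $T(p)$ of $\mathbf Q$ has the vector space $\operatorname{Hom}(E_i,\mathcal O_p)$ at the node $i$, with $\operatorname{Hom}(E_i,E_j)$ acting by composition $\operatorname{Hom}(E_j,\mathcal O_p)\to\operatorname{Hom}(E_i,\mathcal O_p)$. Let $R(\mathbf Q)$ be the affine variety of representations of $\mathbf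 Q$ with the vector space $k$ at every node, with coordinate ring $B$. An element $g=(g_1,\dots,g_n)$ of the group $G=\big(\prod_i \mathrm{GL}_1\big)/\mathbb G_m^{\mathrm{diag}}$ acts on $R(\mathbf Q)$ by multiplying the scalar of an arrow from $s$ to $t$ by $g_tg_s^{-1}$, and on $B$ by $(g\cdot f)(a)=f(g^{-1}\cdot a)$. For a tuple of integers $\chi=(\chi_1,\dots,\chi_n)$ with sum $0$, regarded as the character $g\mapsto\prod_i g_i^{\chi_i}$ of $G$, let $B(r\chi)=\{f\in B : g\cdot f=\prod_i g_i^{r\chi_i}\, f \text{ for all } g\in G\}$. A point $a\in R(\mathbf Q)$ is called $\chi$-semistable if $f(a)\neq 0$ for some $f\in B(r\chi)$ with $r>0$, and a representation is called $\chi$-semistable if it is isomorphic to a $\chi$-semistable point of $R(\mathbf Q)$. The character $\chi$ is called good if $T(p)$ is $\chi$-semistable for every $k$-point $p$ of $V$. Let $(m_{ij})_{1\le i,j\le n}$ be non-negative integers and let $\chi$ be given by $$\chi_\ell=\sum_{i=1}^n m_{i\ell}-\sum_{j=1}^n m_{\ell j}\qquad(1\le \ell\le n).$$ If the sheaf $\mathcal{H}om(E_i,E_j)$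 is generated by its global sections for all $i,j$ with $m_{ij}\neq 0$, then $\chi$ is good. -/

import Mathlib

open CategoryTheory AlgebraicGeometry
open scoped AlgebraicGeometry

universe w u

noncomputable section

/-! ### Quivers with relations, their path algebras and representations -/

section Paths

variable {n : ℕ}

/-- The nodes `1, …, n` of a directed graph with arrows `Arrow i j` from `i` to `j`. -/
@[nolint unusedArguments]
def QuiverNode (_ : Fin n → Fin n → Type w) : Type := Fin n

instance (Arrow : Fin n → Fin n → Type w) : Quiver (QuiverNode Arrow) where
  Hom i j := Arrow i j

/-- The paths from `i` to `j`, including the path of length zero if `i = j`. -/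
abbrev QPath (Arrow : Fin n → Fin n → Type w) (i j : Fin n) :=
  Quiver.Path (V := QuiverNode Arrow) i j

end Paths

/-- A quiver with relations `(Q, I)` on the nodes `1, …, n`: a directed graph together with an
admissible ideal `I` of the path algebra `P(Q) = ⨁ P_ij(Q)`, i.e. a two-sided ideal, homogeneous
for the decomposition into the `P_ij(Q)` (the spaces with basis the paths from `i` to `j`), and
contained in the square of the ideal of paths of nonzero length. -/
structure QuiverWithRelations (k : Type u) [Field k] (n : ℕ) where
  /-- the arrows from `i` to `j` -/
  Arrow : Fin n → Fin n → Type w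
  /-- the component `I_ij` of the ideal -/
  ideal : ∀ i j : Fin n, Submodule k (QPath Arrow i j →₀ k)
  /-- `I` is stable under composition with a path at the start -/
  precomp_mem : ∀ {h i j : Fin n} (p : QPath Arrow h i) (x : QPath Arrow i j →₀ k),
    x ∈ ideal i j → Finsupp.mapDomain (fun q => Quiver.Path.comp p q) x ∈ ideal h j
  /-- `I` is stable under composition with a path at the end -/
  postcomp_mem : ∀ {i j l : Fin n} (q : QPath Arrow j l) (x : QPath Arrow i j →₀ k),
    x ∈ ideal i j → Finsupp.mapDomain (fun p => Quiver.Path.comp p q) x ∈ ideal i l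
  /-- `I` lies in the span of the paths of length at least two -/
  admissible : ∀ {i j : Fin n} (x : QPath Arrow i j →₀ k), x ∈ ideal i j →
    ∀ p ∈ x.support, 2 ≤ p.length

namespace QuiverWithRelations

variable {k : Type u} [Field k] {n : ℕ} (Q : QuiverWithRelations.{w} k n)

/-- The component `P_ij(Q, I) = P_ij(Q) / I_ij` of the path algebra, which is also the space of
morphisms from `i` to `j` in the `k`-linear category attached to the quiver with relations. -/
abbrev PathSpace (i j : Fin n) := (QPath Q.Arrow i j →₀ k) ⧸ Q.ideal i j

/-- The class of a path in the path algebra. -/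
def pathClass {i j : Fin n} (p : QPath Q.Arrow i j) : Q.PathSpace i j :=
  Submodule.Quotient.mk (Finsupp.single p 1)

/-- A representation of a quiver with relations: a `k`-linear functor from the associated
`k`-linear category to vector spaces. (Compatibility with composition is required on classes of
paths, which span.) -/
structure Rep where
  /-- the vector space at a node -/
  obj : Fin n → ModuleCat.{u} k
  /-- the action of the path algebra -/
  map : ∀ i j : Fin n, Q.PathSpace i j →ₗ[k] (obj i →ₗ[k] obj j)
  map_nil : ∀ i : Fin n, map i i (Q.pathClass Quiver.Path.nil) = LinearMap.id
  map_comp : ∀ {i j l : Fin n} (p : QPath Q.Arrow i j) (q : QPath Q.Arrow j l),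
    map i l (Q.pathClass (Quiver.Path.comp p q)) =
      (map j l (Q.pathClass q)).comp (map i j (Q.pathClass p))

/-- Isomorphisms of representations. -/
structure Rep.Iso {Q : QuiverWithRelations.{w} k n} (M N : Q.Rep) where
  /-- the isomorphisms at the nodes -/
  equiv : ∀ i : Fin n, M.obj i ≃ₗ[k] N.obj i
  naturality : ∀ (i j : Fin n) (x : Q.PathSpace i j) (v : M.obj i),
    equiv j (M.map i j x v) = N.map i j x (equiv i v)

/-! ### The variety of representations of dimension vector `(1, …, 1)` -/

/-- The scalar by which a path acts, given scalars for the arrows. -/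
def evalPath {Arrow : Fin n → Fin n → Type w} (a : ∀ i j : Fin n, Arrow i j → k) (i : Fin n) :
    ∀ {j : Fin n}, QPath Arrow i j → k
  | _, .nil => 1
  | _, .cons p e => a _ _ e * evalPath a i p

lemma evalPath_comp {Arrow : Fin n → Fin n → Type w} (a : ∀ i j : Fin n, Arrow i j → k)
    {i j l : Fin n} (p : QPath Arrow i j) (q : QPath Arrow j l) :
    evalPath a i (Quiver.Path.comp p q) = evalPath a j q * evalPath a i p := by
  induction q with
  | nil => exact (one_mul _).symm
  | cons q e ih =>
    change a _ _ e * evalPath a i (Quiver.Path.comp p q) = a _ _ e * evalPath a j q * _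
    rw [ih, mul_assoc]

/-- The set `R(Q, I)` of representations that map every node to the fixed vector space `k`
(dimension vector `(1, …, 1)`), in coordinates: a scalar for every arrow, subject to the
relations in `I`. -/
def RepVariety : Type (max w u) :=
  {a : ∀ i j : Fin n, Q.Arrow i j → k //
    ∀ (i j : Fin n), ∀ x ∈ Q.ideal i j, Finsupp.linearCombination k (evalPath a i) x = 0}

variable {Q}

/-- The representation given by a point of `R(Q, I)`. -/
def RepVariety.toRep (a : Q.RepVariety) : Q.Rep where
  obj _ := ModuleCat.of k k
  map i j := (LinearMap.toSpanSingleton k (k →ₗ[k] k) LinearMap.id).comp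
    ((Q.ideal i j).liftQ (Finsupp.linearCombination k (evalPath a.1 i))
      (fun x hx => a.2 i j x hx))
  map_nil i := by
    ext
    simp only [pathClass, LinearMap.comp_apply]
    erw [Submodule.liftQ_apply]
    simp [evalPath]
  map_comp p q := by
    ext
    simp only [pathClass, LinearMap.comp_apply]
    erw [Submodule.liftQ_apply, Submodule.liftQ_apply, Submodule.liftQ_apply]
    simp [evalPath_comp]

lemma evalPath_act (g : Fin n → kˣ) {Arrow : Fin n → Fin n → Type w}
    (a : ∀ i j : Fin n, Arrow i j → k) {i j : Fin n} (p : QPath Arrow i j) :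
    evalPath (fun s t e => (g t : k) * a s t e * ((g s)⁻¹ : kˣ)) i p =
      (g j : k) * ((g i)⁻¹ : kˣ) * evalPath a i p := by
  induction p with
  | nil => simp [evalPath]
  | @cons b c p e ih =>
    change (g c : k) * a b c e * ((g b)⁻¹ : kˣ) *
      evalPath (fun s t e => (g t : k) * a s t e * ((g s)⁻¹ : kˣ)) i p =
      (g c : k) * ((g i)⁻¹ : kˣ) * (a b c e * evalPath a i p)
    rw [ih]
    have h : (((g b)⁻¹ : kˣ) : k) * (g b : k) = 1 := (g b).inv_mul
    linear_combination (g c : k) * a b c e * (((g i)⁻¹ : kˣ) : k) * evalPath a i p * h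

/-- The action of `∏ᵢ GL(1)` on `R(Q, I)` by change of basis at the nodes: the scalar of an arrow
from `s` to `t` is multiplied by `g_t` and by `g_s⁻¹`. The diagonal `𝔾_m` acts trivially. -/
def RepVariety.act (g : Fin n → kˣ) (a : Q.RepVariety) : Q.RepVariety :=
  ⟨fun s t e => (g t : k) * a.1 s t e * ((g s)⁻¹ : kˣ), by
    intro i j x hx
    have h := a.2 i j x hx
    have h' : (evalPath (fun s t e => (g t : k) * a.1 s t e * ((g s)⁻¹ : kˣ)) i :
        QPath Q.Arrow i j → k) = ((g j : k) * ((g i)⁻¹ : kˣ)) • evalPath a.1 i := by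
      funext p
      exact evalPath_act g a.1 p
    rw [h', Finsupp.linearCombination_apply]
    rw [Finsupp.linearCombination_apply] at h
    simp only [Pi.smul_apply, smul_comm _ ((g j : k) * ((g i)⁻¹ : kˣ))]
    rw [← Finsupp.smul_sum, h, smul_zero]⟩

variable (Q)

/-- The affine coordinate ring `B` of `R(Q, I)`: the functions given by polynomials in the
coordinates. -/
def coordinateRing : Subalgebra k (Q.RepVariety → k) :=
  (MvPolynomial.aeval (R := k) (σ := Σ i j : Fin n, Q.Arrow i j)
    (fun e (a : Q.RepVariety) => a.1 e.1 e.2.1 e.2.2)).range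

end QuiverWithRelations

/-- The characters of `G = (∏ᵢ GL(1)) / 𝔾_m`: tuples of integers with sum zero. -/
abbrev QuiverCharacter (n : ℕ) : Type := {χ : Fin n → ℤ // ∑ i, χ i = 0}

namespace QuiverWithRelations

variable {k : Type u} [Field k] {n : ℕ} (Q : QuiverWithRelations.{w} k n)

/-- The eigenspace `B(θ)` of the coordinate ring for the character `g ↦ ∏ᵢ gᵢ ^ θᵢ`, for the
action `(g · f)(a) = f(g⁻¹ · a)` of the group on functions. -/
def eigenspace (θ : QuiverCharacter n) : Set (Q.RepVariety → k) :=
  {f | f ∈ Q.coordinateRing ∧ ∀ (g : Fin n → kˣ) (a : Q.RepVariety),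
    f (a.act g⁻¹) = ((∏ i, g i ^ θ.1 i : kˣ) : k) * f a}

variable {Q}

/-- A point `a` of `R(Q, I)` is `χ`-semistable if some function in `B(rχ)`, `r > 0`, does not
vanish at `a`. -/
def RepVariety.IsSemistable (χ : QuiverCharacter n) (a : Q.RepVariety) : Prop :=
  ∃ r : ℕ, 0 < r ∧ ∃ θ : QuiverCharacter n, (∀ i, θ.1 i = r * χ.1 i) ∧
    ∃ f ∈ Q.eigenspace θ, f a ≠ 0

/-- A representation is of dimension vector `(1, …, 1)` and `χ`-semistable if it is isomorphic to
a `χ`-semistable point of `R(Q, I)`. -/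
def Rep.IsSemistable (χ : QuiverCharacter n) (M : Q.Rep) : Prop :=
  ∃ a : Q.RepVariety, Nonempty (M.Iso a.toRep) ∧ a.IsSemistable χ

end QuiverWithRelations

/-- The character `χ = ∑_{i,j} m_ij (0, …, -1, …, 1, …, 0)`, with `-1` in the spot `i` and `1` in
the spot `j`, attached to non-negative integers `m_ij`. -/
def characterOf {n : ℕ} (m : Fin n → Fin n → ℕ) : QuiverCharacter n :=
  ⟨fun l => ∑ i, (m i l : ℤ) - ∑ j, (m l j : ℤ), by
    rw [Finset.sum_sub_distrib, Finset.sum_comm, sub_self]⟩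

/-! ### Sheaves of modules on a `k`-scheme -/

namespace AlgebraicGeometry.Scheme.Modules

variable {X : Scheme.{u}}

/-- Multiplication by a global function, as an endomorphism of an `𝒪_X`-module. -/
def globalSMul (c : Γ(X, ⊤)) (M : X.Modules) : M ⟶ M :=
  ⟨{ app U := ModuleCat.ofHom
        (LinearMap.lsmul Γ(X, U.unop) Γ(M, U.unop) (X.presheaf.map (homOfLE le_top).op c))
     naturality := by
      intro U V f
      ext x
      have h := Modules.map_smul M f.unop (X.presheaf.map (homOfLE le_top).op c) x
      rw [← CommRingCat.comp_apply, ← X.presheaf.map_comp] at h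
      exact h.symm }⟩

lemma globalSMul_app (c : Γ(X, ⊤)) (M : X.Modules) (U : X.Opens) (x : Γ(M, U)) :
    (globalSMul c M).app U x =
      (X.presheaf.map (homOfLE (le_top : U ≤ ⊤)).op c : Γ(X, U)) • x := rfl

/-- Global functions act on all `𝒪_X`-modules, compatibly with all morphisms. -/
def globalToCenter (X : Scheme.{u}) : Γ(X, ⊤) →+* CatCenter X.Modules where
  toFun c :=
    { app M := globalSMul c M
      naturality M N φ := by
        ext U x
        exact (Modules.Hom.app_smul φ (X.presheaf.map (homOfLE le_top).op c) x).symm }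
  map_one' := by
    ext M U x
    change (globalSMul 1 M).app U x = x
    rw [globalSMul_app, map_one, one_smul]
  map_zero' := by
    ext M U x
    change (globalSMul 0 M).app U x = 0
    rw [globalSMul_app, map_zero, zero_smul]
  map_add' c d := by
    ext M U x
    change (globalSMul (c + d) M).app U x =
      (globalSMul c M).app U x + (globalSMul d M).app U x
    rw [globalSMul_app, globalSMul_app, globalSMul_app, map_add, add_smul]
  map_mul' c d := by
    ext M U x
    change (globalSMul (c * d) M).app U x =
      (globalSMul c M).app U ((globalSMul d M).app U x)
    rw [globalSMul_app, globalSMul_app, globalSMul_app, map_mul, mul_smul]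

/-- The `k`-linear structure on the category of sheaves of modules over a `k`-scheme: scalars act
through the structure morphism. -/
instance linearOfOver (k : Type u) [Field k] (V : Scheme.{u}) [V.Over (Spec (.of k))] :
    Linear k V.Modules :=
  Linear.ofRingMorphism ((globalToCenter V).comp
    ((Scheme.ΓSpecIso (.of k)).inv ≫ (V ↘ Spec (.of k)).appTop).hom)

/-- A line bundle: an `𝒪_X`-module locally isomorphic to `𝒪_X`. -/
def IsLineBundle (M : X.Modules) : Prop :=
  ∀ x : X, ∃ U : X.Opens, x ∈ U ∧
    Nonempty (M.restrict U.ι ≅ SheafOfModules.unit (U : Scheme.{u}).ringCatSheaf)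

/-- The sections over `U` of the sheaf `ℋom(M, N)`, i.e. the morphisms of `𝒪_U`-modules
`M|_U ⟶ N|_U`. -/
abbrev LocalHom (M N : X.Modules) (U : X.Opens) := M.restrict U.ι ⟶ N.restrict U.ι

/-- The sheaf `ℋom(M, N)` is generated by its global sections: near every point `x` of an open
set `U`, every section `ψ` of `ℋom(M, N)` over `U` is a linear combination, with coefficients in
the functions on a neighbourhood `W` of `x`, of global sections of `ℋom(M, N)`. -/
def HomGloballyGenerated (M N : X.Modules) : Prop :=
  ∀ (U : X.Opens) (ψ : LocalHom M N U) (x : (U : Scheme.{u})),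
    ∃ W : (U : Scheme.{u}).Opens, x ∈ W ∧
      ∃ (r : ℕ) (c : Fin r → Γ((U : Scheme.{u}), W)) (φ : Fin r → (M ⟶ N)),
        ∀ (W' : (U : Scheme.{u}).Opens) (h : W' ≤ W) (s : Γ(M.restrict U.ι, W')),
          ψ.app W' s = ∑ l, (U : Scheme.{u}).presheaf.map (homOfLE h).op (c l) •
            ((restrictFunctor U.ι).map (φ l)).app W' s

/-- The structure sheaf `𝒪_p` of a `k`-point `p` of a scheme, as a sheaf of modules on the
scheme. -/
def pointSheaf {k : Type u} [Field k] (p : Spec (.of k) ⟶ X) : X.Modules :=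
  (pushforward p).obj (SheafOfModules.unit (Spec (.of k)).ringCatSheaf)

end AlgebraicGeometry.Scheme.Modules

/-! ### The quiver of a collection of sheaves and the tautological representations -/

section Tautological

open AlgebraicGeometry.Scheme.Modules

variable {k : Type u} [Field k] {n : ℕ} {V : Scheme.{u}} [V.Over (Spec (.of k))]

/-- An isomorphism of algebras `P(Q, I) ≅ End(⨁ Eᵢ)ᵒᵖ` matching the idempotents at the nodes with
the projections to the summands: isomorphisms of `P_ij(Q, I)` with the space of morphisms
`E_j ⟶ E_i`, compatible with units and with composition (checked on classes of paths, which
span). -/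
structure PathAlgebraIso (Q : QuiverWithRelations.{w} k n) (E : Fin n → V.Modules) where
  /-- the isomorphism in degree `ij` -/
  equiv : ∀ i j : Fin n, Q.PathSpace i j ≃ₗ[k] (E j ⟶ E i)
  equiv_nil : ∀ i : Fin n, equiv i i (Q.pathClass Quiver.Path.nil) = 𝟙 (E i)
  equiv_comp : ∀ {i j l : Fin n} (p : QPath Q.Arrow i j) (q : QPath Q.Arrow j l),
    equiv i l (Q.pathClass (Quiver.Path.comp p q)) =
      equiv j l (Q.pathClass q) ≫ equiv i j (Q.pathClass p)

namespace PathAlgebraIso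

variable {Q : QuiverWithRelations.{w} k n} {E : Fin n → V.Modules}

/-- The functor `F` from sheaves to representations of the quiver: the node `i` is mapped to
`Hom(Eᵢ, 𝓕)`, and `P_ij(Q, I) ≅ Hom(E_j, E_i)` acts by composition. -/
def homRep (Φ : PathAlgebraIso Q E) (𝓕 : V.Modules) : Q.Rep where
  obj i := ModuleCat.of k (E i ⟶ 𝓕)
  map i j := (Linear.comp (S := k) (E j) (E i) 𝓕).comp (Φ.equiv i j).toLinearMap
  map_nil i := by
    refine LinearMap.ext fun f => ?_
    change Φ.equiv i i _ ≫ f = f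
    rw [Φ.equiv_nil, Category.id_comp]
  map_comp {i j l} p q := by
    refine LinearMap.ext fun f => ?_
    change Φ.equiv i l _ ≫ f = Φ.equiv j l _ ≫ Φ.equiv i j _ ≫ f
    rw [Φ.equiv_comp, Category.assoc]

/-- The tautological representation `T(p) = F(𝒪_p)` at a point `p`. -/
def tautological (Φ : PathAlgebraIso Q E) (p : Spec (.of k) ⟶ V) : Q.Rep :=
  Φ.homRep (pointSheaf p)

/-- A character `χ` is good (for a collection of line bundles) if the tautological representation
at every `k`-point of `V` is `χ`-semistable. -/
def IsGood (Φ : PathAlgebraIso Q E) (χ : QuiverCharacter n) : Prop :=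
  ∀ p : Spec (.of k) ⟶ V, p ≫ (V ↘ Spec (.of k)) = 𝟙 _ →
    (Φ.tautological p).IsSemistable χ

end PathAlgebraIso

end Tautological

end

/-! At a `k`-point `p` every `Hom(E_i, 𝒪_p)` is a line (`finrank_hom_pointSheaf`), so `T(p)` is
isomorphic to a point `a` of `R(Q, I)`. A combination `x_ij` of paths from `j` to `i` acts at each
point of `R(Q, I)` by a scalar. This is a polynomial function, whose weight has `-1` at `i` and `1`
at `j`. Hence `∏ x_ij ^ m_ij` lies in `B(χ)`, and it is nonzero at `a` once each `x_ij` with `m_ij ≠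
0` acts nontrivially on `T(p)` (`Rep.isSemistable_characterOf`).

Through the path algebra isomorphism, this asks for a global morphism `E_i ⟶ E_j` with a nonzero
composite to `𝒪_p`. Near `p` the two line bundles are isomorphic, and global generation writes a
local isomorphism as a combination of global morphisms. If all of these composed to zero with maps
to `𝒪_p`, so would the isomorphism, contradicting `Hom(E_j, 𝒪_p) ≠ 0`
(`HomGloballyGenerated.exists_comp_ne_zero`). -/

namespace QuiverWithRelations

variable {k : Type u} [Field k] {n : ℕ} {Q : QuiverWithRelations.{w} k n}

/-! ### Representations by lines as points of `R(Q, I)`. -/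

lemma RepVariety.toRep_map_mk (a : Q.RepVariety) (i j : Fin n) (x : QPath Q.Arrow i j →₀ k)
    (v : k) :
    a.toRep.map i j (Submodule.Quotient.mk x) v =
      Finsupp.linearCombination k (evalPath a.1 i) x * v := by
  rfl

/-- Reduces statements about the path algebra to classes of paths, the only elements on which a
`Rep` is required to respect composition. -/
lemma mk_eq_linearCombination_pathClass {i j : Fin n} (x : QPath Q.Arrow i j →₀ k) :
    (Submodule.Quotient.mk x : Q.PathSpace i j) = Finsupp.linearCombination k Q.pathClass x := by
  change (Q.ideal i j).mkQ x = _
  induction x using Finsupp.induction_linear with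
  | zero => simp
  | add x y hx hy => rw [map_add, map_add, hx, hy]
  | single p c =>
    rw [Finsupp.linearCombination_single, ← mul_one c, ← smul_eq_mul, ← Finsupp.smul_single,
      map_smul]
    simp [pathClass]

/-- The coordinates of a representation with one-dimensional spaces, for given bases. -/
noncomputable def Rep.coordinates (M : Q.Rep) (e : ∀ i, M.obj i ≃ₗ[k] k) (i j : Fin n)
    (x : Q.Arrow i j) : k :=
  e j (M.map i j (Q.pathClass (Quiver.Hom.toPath (V := QuiverNode Q.Arrow) x)) ((e i).symm 1))

lemma Rep.evalPath_coordinates (M : Q.Rep) (e : ∀ i, M.obj i ≃ₗ[k] k) {i j : Fin n}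
    (p : QPath Q.Arrow i j) :
    evalPath (M.coordinates e) i p = e j (M.map i j (Q.pathClass p) ((e i).symm 1)) := by
  induction p with
  | nil =>
    have h := M.map_nil i
    change 1 = e i (M.map i i (Q.pathClass Quiver.Path.nil) ((e i).symm 1))
    rw [h]
    simp
  | @cons b c p x ih =>
    change M.coordinates e b c x * evalPath (M.coordinates e) i p = _
    rw [ih]
    have h := M.map_comp p (Quiver.Hom.toPath (V := QuiverNode Q.Arrow) x)
    change _ = e c (M.map i c (Q.pathClass (Quiver.Path.comp p
      (Quiver.Hom.toPath (V := QuiverNode Q.Arrow) x))) ((e i).symm 1))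
    -- A vector `w` of a line is `e w • e.symm 1`, so the scalar of `p` can be moved inside the map
    -- of the last arrow.
    rw [h, Rep.coordinates, mul_comm, ← smul_eq_mul, ← map_smul, ← map_smul, ← map_smul]
    rw [smul_eq_mul, mul_one, LinearEquiv.symm_apply_apply]
    rfl

/-- Gives both the relations in `toPoint`, since elements of `I` have zero class, and the naturality
in `isoToPoint`. -/
lemma Rep.linearCombination_coordinates (M : Q.Rep) (e : ∀ i, M.obj i ≃ₗ[k] k) {i j : Fin n}
    (x : QPath Q.Arrow i j →₀ k) :
    Finsupp.linearCombination k (evalPath (M.coordinates e) i) x =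
      e j (M.map i j (Submodule.Quotient.mk x) ((e i).symm 1)) := by
  rw [mk_eq_linearCombination_pathClass]
  induction x using Finsupp.induction_linear with
  | zero => simp
  | add x y hx hy => simp only [map_add, hx, hy, LinearMap.add_apply]
  | single p c => simp [M.evalPath_coordinates e]

/-- The point of `R(Q, I)` given by a representation with one-dimensional spaces and bases. -/
noncomputable def Rep.toPoint (M : Q.Rep) (e : ∀ i, M.obj i ≃ₗ[k] k) : Q.RepVariety :=
  ⟨M.coordinates e, fun i j x hx => by
    rw [M.linearCombination_coordinates e, (Submodule.Quotient.mk_eq_zero _).mpr hx]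
    simp⟩

/-- A representation with one-dimensional spaces is isomorphic to a point of `R(Q, I)`. -/
noncomputable def Rep.isoToPoint (M : Q.Rep) (e : ∀ i, M.obj i ≃ₗ[k] k) :
    M.Iso (M.toPoint e).toRep where
  equiv := e
  naturality i j x v := by
    obtain ⟨x, rfl⟩ := Submodule.Quotient.mk_surjective _ x
    refine Eq.trans ?_ (RepVariety.toRep_map_mk (M.toPoint e) i j x (e i v)).symm
    change _ = Finsupp.linearCombination k (evalPath (M.coordinates e) i) x * _
    rw [M.linearCombination_coordinates e, mul_comm, ← smul_eq_mul, ← map_smul, ← map_smul,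
      ← map_smul, smul_eq_mul, mul_one, LinearEquiv.symm_apply_apply]
    rfl

/-! ### Semi-invariant functions from the path algebra. -/

/-- The function on `R(Q, I)` given by an element of the path algebra. -/
noncomputable def pathFunction {i j : Fin n} (x : QPath Q.Arrow i j →₀ k) : Q.RepVariety → k :=
  fun a => Finsupp.linearCombination k (evalPath a.1 i) x

lemma evalPath_mem_coordinateRing {i j : Fin n} (p : QPath Q.Arrow i j) :
    (fun a : Q.RepVariety => evalPath a.1 i p) ∈ Q.coordinateRing := by
  induction p with
  | nil => exact Q.coordinateRing.one_mem
  | @cons b c p x ih =>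
    refine Q.coordinateRing.mul_mem (x := fun a : Q.RepVariety => a.1 b c x) ?_ ih
    exact ⟨MvPolynomial.X ⟨b, c, x⟩, MvPolynomial.aeval_X _ _⟩

lemma pathFunction_mem_coordinateRing {i j : Fin n} (x : QPath Q.Arrow i j →₀ k) :
    pathFunction x ∈ Q.coordinateRing := by
  have h : pathFunction (Q := Q) x =
      x.sum fun p c => c • fun a : Q.RepVariety => evalPath a.1 i p := by
    funext a
    simp [pathFunction, Finsupp.linearCombination_apply, Finsupp.sum]
  rw [h]
  exact Q.coordinateRing.sum_mem fun p _ =>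
    Q.coordinateRing.smul_mem (evalPath_mem_coordinateRing p) _

/-- The base changes at the intermediate nodes of a path cancel, so the weight depends only on the
two ends. -/
lemma pathFunction_act {i j : Fin n} (x : QPath Q.Arrow i j →₀ k) (g : Fin n → kˣ)
    (a : Q.RepVariety) :
    pathFunction x (a.act g) = ((g j * (g i)⁻¹ : kˣ) : k) * pathFunction x a := by
  have h : (evalPath (a.act g).1 i : QPath Q.Arrow i j → k) =
      ((g j * (g i)⁻¹ : kˣ) : k) • evalPath a.1 i := by
    funext p
    exact (evalPath_act g a.1 p).trans (by simp)
  simp only [pathFunction, h, Finsupp.linearCombination_apply, Pi.smul_apply, smul_eq_mul,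
    Finsupp.mul_sum, mul_left_comm]

lemma prod_zpow_characterOf {A : Type*} [CommGroup A] (m : Fin n → Fin n → ℕ) (g : Fin n → A) :
    ∏ l, g l ^ (characterOf m).1 l = ∏ i, ∏ j, (g j * (g i)⁻¹) ^ m i j := by
  simp only [characterOf, zpow_sub, Finset.prod_mul_distrib, mul_pow, inv_pow,
    Finset.prod_inv_distrib]
  congr 1
  · rw [Finset.prod_comm]
    refine Finset.prod_congr rfl fun j _ => ?_
    rw [Finset.prod_pow_eq_pow_sum, ← zpow_natCast]
    push_cast
    rfl
  · congr 1
    refine Finset.prod_congr rfl fun i _ => ?_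
    rw [Finset.prod_pow_eq_pow_sum, ← zpow_natCast]
    push_cast
    rfl

/-- The factor `x i j` runs from `j` to `i`; the inverse in the action on functions turns its weight
`g i * (g j)⁻¹` into `g j * (g i)⁻¹`, the factor of `prod_zpow_characterOf`. -/
lemma prod_pathFunction_mem_eigenspace (m : Fin n → Fin n → ℕ)
    (x : ∀ i j, QPath Q.Arrow j i →₀ k) :
    (∏ i, ∏ j, pathFunction (x i j) ^ m i j) ∈ Q.eigenspace (characterOf m) := by
  refine ⟨Subalgebra.prod_mem _ fun i _ => Subalgebra.prod_mem _ fun j _ =>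
    Subalgebra.pow_mem _ (pathFunction_mem_coordinateRing _) _, fun g a => ?_⟩
  rw [prod_zpow_characterOf]
  simp only [Finset.prod_apply, Pi.pow_apply, pathFunction_act, mul_pow, Finset.prod_mul_distrib,
    Pi.inv_apply, inv_inv]
  congr 1
  push_cast
  simp only [mul_pow, Finset.prod_mul_distrib]
  rw [mul_comm]

/-- A representation with one-dimensional spaces is semistable for the character attached to `m`
if some element of the path algebra from `j` to `i` acts nontrivially whenever `m i j ≠ 0`. -/
lemma Rep.isSemistable_characterOf (M : Q.Rep) (hM : ∀ i, Module.finrank k (M.obj i) = 1)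
    (m : Fin n → Fin n → ℕ) (hm : ∀ i j, m i j ≠ 0 → ∃ x, M.map j i x ≠ 0) :
    M.IsSemistable (characterOf m) := by
  have e (i : Fin n) : M.obj i ≃ₗ[k] k := by
    have := Module.finite_of_finrank_eq_succ (hM i)
    exact LinearEquiv.ofFinrankEq _ _ ((hM i).trans (Module.finrank_self k).symm)
  have hx (i j : Fin n) : ∃ x : QPath Q.Arrow j i →₀ k, m i j ≠ 0 →
      M.map j i (Submodule.Quotient.mk x) ≠ 0 := by
    by_cases h : m i j = 0
    -- An arbitrary value: this factor is raised to the power `0`.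
    · exact ⟨0, fun h' => (h' h).elim⟩
    · obtain ⟨x, hx⟩ := hm i j h
      obtain ⟨x, rfl⟩ := Submodule.Quotient.mk_surjective _ x
      exact ⟨x, fun _ => hx⟩
  choose x hx using hx
  refine ⟨M.toPoint e, ⟨M.isoToPoint e⟩, 1, one_pos, characterOf m, fun i => by simp, _,
    prod_pathFunction_mem_eigenspace m x, ?_⟩
  simp only [Finset.prod_apply, Pi.pow_apply]
  refine Finset.prod_ne_zero_iff.mpr fun i _ => Finset.prod_ne_zero_iff.mpr fun j _ => ?_
  by_cases h : m i j = 0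
  · simp [h]
  -- The value of the factor is the image of the basis vector; on a line, its vanishing forces the
  -- whole map to vanish.
  refine pow_ne_zero _ fun h0 => hx i j h (LinearMap.ext fun v => ?_)
  replace h0 : Finsupp.linearCombination k (evalPath (M.coordinates e) j) (x i j) = 0 := h0
  rw [M.linearCombination_coordinates e, LinearEquiv.map_eq_zero_iff] at h0
  have hv : v = e j v • (e j).symm 1 := by
    rw [← map_smul, smul_eq_mul, mul_one, LinearEquiv.symm_apply_apply]
  rw [hv, map_smul, h0, smul_zero, LinearMap.zero_apply]

end QuiverWithRelations

namespace AlgebraicGeometry.Scheme.Modules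

variable {X : Scheme.{u}}

/-! ### Trivializations and generators. -/

/-- The structure sheaf of a scheme, as a module over itself. -/
noncomputable abbrev structureModule (X : Scheme.{u}) : X.Modules :=
  SheafOfModules.unit X.ringCatSheaf

instance {Y : Scheme.{u}} (f : X ⟶ Y) [IsOpenImmersion f] : (restrictFunctor f).Additive where
  map_add := rfl

/-- A trivialization over an open set restricts to smaller open sets. -/
lemma nonempty_restrict_iso_unit_of_le {M : X.Modules} {U W : X.Opens} (h : W ≤ U)
    (e : M.restrict U.ι ≅ structureModule U) :
    Nonempty (M.restrict W.ι ≅ structureModule W) :=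
  ⟨(restrictFunctorCongr (X.homOfLE_ι h).symm).app M ≪≫
    (restrictFunctorComp (X.homOfLE h) U.ι).app M ≪≫
    (restrictFunctor (X.homOfLE h)).mapIso e ≪≫ restrictUnitIso (X.homOfLE h)⟩

/-- The generator attached to a trivialization. -/
noncomputable def generator {M : X.Modules} (e : M ≅ structureModule X) (W : X.Opens) :
    Γ(M, W) :=
  e.inv.app W (1 : Γ(X, W))

lemma map_generator {M : X.Modules} (e : M ≅ structureModule X)
    {W W' : X.Opens} (i : W' ⟶ W) :
    M.presheaf.map i.op (generator e W) = generator e W' := by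
  have h := congr($(e.inv.mapPresheaf.naturality i.op) (1 : Γ(X, W)))
  refine h.symm.trans (congrArg (e.inv.app W') (?_ : X.presheaf.map i.op (1 : Γ(X, W)) = 1))
  exact map_one _

lemma exists_smul_generator {M : X.Modules} (e : M ≅ structureModule X)
    {W : X.Opens} (t : Γ(M, W)) : ∃ c : Γ(X, W), t = c • generator e W := by
  let c : Γ(X, W) := e.hom.app W t
  refine ⟨c, ?_⟩
  have h := e.inv.app_smul (U := W) c (1 : Γ(X, W))
  refine Eq.trans ?_ h
  have h2 : (c • (1 : Γ(X, W)) : Γ(X, W)) = c := mul_one c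
  refine Eq.trans ?_ (congrArg (e.inv.app W) h2.symm)
  exact congr($((congrArg (fun f => Hom.app f W) e.hom_inv_id.symm)) t)

lemma app_map {M N : X.Modules} (f : M ⟶ N) {U W : X.Opens} (i : W ⟶ U) (t : Γ(M, U)) :
    f.app W (M.presheaf.map i.op t) = N.presheaf.map i.op (f.app U t) :=
  congr($(f.mapPresheaf.naturality i.op) t)

/-! ### Morphisms from a line bundle to `𝒪_p`. -/

/-- A morphism to the structure sheaf of a point is determined by its value on a generator. -/
lemma eq_zero_of_app_generator {k : Type u} [Field k] (p : Spec (.of k) ⟶ X) {M : X.Modules}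
    {U : X.Opens} (e : M.restrict U.ι ≅ structureModule U)
    (f : M ⟶ pointSheaf p) (W₀ : (U : Scheme.{u}).Opens) (hW₀ : p ⁻¹ᵁ (U.ι ''ᵁ W₀) = ⊤)
    (hf : ((restrictFunctor U.ι).map f).app W₀ (generator e W₀) = 0) : f = 0 := by
  refine hom_ext _ _ fun W => ?_
  ext t
  let W₁ : (U : Scheme.{u}).Opens := W₀ ⊓ U.ι ⁻¹ᵁ W
  have hle : U.ι ''ᵁ W₁ ≤ W := by
    refine (U.ι.image_mono inf_le_right).trans ?_
    exact U.ι.image_preimage_le W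
  -- The image of `p` already lies in `W₀`, so shrinking `W` to `W₁` does not change the sections of
  -- `𝒪_p`.
  have hpre : p ⁻¹ᵁ (U.ι ''ᵁ W₁) = p ⁻¹ᵁ W := by
    refine le_antisymm (p.preimage_mono hle) fun y hy => ?_
    obtain ⟨z, hz, hzy⟩ := (hW₀ ▸ trivial : y ∈ p ⁻¹ᵁ (U.ι ''ᵁ W₀))
    refine ⟨z, ⟨hz, ?_⟩, hzy⟩
    exact (hzy ▸ hy : U.ι z ∈ W)
  have hinj : Function.Injective ((pointSheaf p).presheaf.map (homOfLE hle).op) := by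
    change Function.Injective ((Spec (.of k)).presheaf.map (homOfLE (p.preimage_mono hle)).op)
    have : IsIso (homOfLE (p.preimage_mono hle)) := ⟨homOfLE hpre.ge, rfl, rfl⟩
    exact (ConcreteCategory.bijective_of_isIso _).1
  refine hinj ?_
  rw [← app_map]
  obtain ⟨c, hc⟩ := exists_smul_generator e (W := W₁) (M.presheaf.map (homOfLE hle).op t)
  have h1 : ((restrictFunctor U.ι).map f).app W₁ (generator e W₁) = 0 := by
    rw [← map_generator e (homOfLE inf_le_left : W₁ ⟶ W₀), app_map, hf, map_zero]
  have h2 := ((restrictFunctor U.ι).map f).app_smul c (generator e W₁)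
  rw [h1, smul_zero, ← hc] at h2
  refine h2.trans ?_
  rw [Hom.zero_app]
  exact (map_zero _).symm

lemma smul_app {k : Type u} [Field k] {V : Scheme.{u}} [V.Over (Spec (.of k))] {M N : V.Modules}
    (c : k) (f : M ⟶ N) (U : V.Opens) (s : Γ(M, U)) :
    (c • f).app U s = (V.presheaf.map (homOfLE (le_top : U ≤ ⊤)).op
      ((V ↘ Spec (.of k)).appTop ((Scheme.ΓSpecIso (.of k)).inv c)) : Γ(V, U)) • f.app U s := by
  have h := Linear.smulOfRingMorphism_smul_eq' ((globalToCenter V).comp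
    ((Scheme.ΓSpecIso (.of k)).inv ≫ (V ↘ Spec (.of k)).appTop).hom) c f
  exact congr($((congrArg (fun f => Hom.app f U) h)) s)

/-- There is a nonzero morphism to the structure sheaf of a point. -/
lemma exists_hom_pointSheaf_ne_zero {k : Type u} [Field k] (p : Spec (.of k) ⟶ X) {M : X.Modules}
    {U : X.Opens} (hp : p ⁻¹ᵁ U = ⊤)
    (e : M.restrict U.ι ≅ structureModule U) :
    ∃ f : M ⟶ pointSheaf p, f ≠ 0 := by
  have hr : Set.range p ⊆ Set.range U.ι := by
    rw [Scheme.Opens.range_ι]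
    rintro _ ⟨y, rfl⟩
    exact (hp ▸ trivial : y ∈ p ⁻¹ᵁ U)
  let q : Spec (.of k) ⟶ U := IsOpenImmersion.lift U.ι p hr
  have hq : q ≫ U.ι = p := IsOpenImmersion.lift_fac _ _ _
  let ε : structureModule U ⟶
      (pushforward q).obj (structureModule (Spec (.of k))) :=
    SheafOfModules.unitToPushforwardObjUnit _
  let i : (pushforward U.ι).obj
      ((pushforward q).obj (structureModule (Spec (.of k)))) ≅ pointSheaf p :=
    (pushforwardComp q U.ι ≪≫ pushforwardCongr hq).app _
  -- Evaluation at `p` on the trivialized restriction, extended to `M` by adjunction; it is nonzero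
  -- because it sends `1` to `1`.
  refine ⟨(restrictAdjunction U.ι).homEquiv _ _ (e.hom ≫ ε) ≫ i.hom, fun h => ?_⟩
  rw [← Limits.zero_comp (f := i.hom), cancel_mono] at h
  have h0 : e.hom ≫ ε = 0 := by
    rw [← (restrictAdjunction U.ι).homAddEquiv_zero] at h
    exact ((restrictAdjunction U.ι).homEquiv _ _).injective h
  have h1 : ε = 0 := by rw [← cancel_epi e.hom, h0, Limits.comp_zero]
  have h2 : q.app ⊤ 1 = 0 := congr($(congrArg (fun f => Hom.app f ⊤) h1) (1 : Γ(U, ⊤)))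
  rw [map_one] at h2
  exact one_ne_zero (α := Γ(Spec (.of k), ⊤)) h2

/-- On the one point scheme `Spec k`, mapped to `V` over `k`, all functions come uniquely from `k`. -/
lemma bijective_app_of_comp_eq_id {k : Type u} [Field k] {V : Scheme.{u}} [V.Over (Spec (.of k))]
    (p : Spec (.of k) ⟶ V) (hp : p ≫ (V ↘ Spec (.of k)) = 𝟙 _) {W : V.Opens}
    (hW : p ⁻¹ᵁ W = ⊤) : Function.Bijective fun c : k =>
      p.app W (V.presheaf.map (homOfLE (le_top : W ≤ ⊤)).op
        ((V ↘ Spec (.of k)).appTop ((Scheme.ΓSpecIso (.of k)).inv c))) := by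
  have h : (Scheme.ΓSpecIso (.of k)).inv ≫ (V ↘ Spec (.of k)).appTop ≫
      V.presheaf.map (homOfLE (le_top : W ≤ ⊤)).op ≫ p.app W =
      (Scheme.ΓSpecIso (.of k)).inv ≫
        (Spec (.of k)).presheaf.map (homOfLE (le_top : p ⁻¹ᵁ W ≤ ⊤)).op := by
    -- Since `p` is a section of the structure morphism, constants pull back to themselves.
    have h1 := congrArg Scheme.Hom.appTop hp
    rw [Scheme.Hom.comp_appTop, Scheme.Hom.id_appTop] at h1
    rw [p.naturality]
    exact congrArg (_ ≫ ·) ((reassoc_of% h1) _)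
  have : IsIso (homOfLE (le_top : p ⁻¹ᵁ W ≤ ⊤)) := ⟨homOfLE hW.ge, rfl, rfl⟩
  have h2 : (fun c : k => p.app W (V.presheaf.map (homOfLE (le_top : W ≤ ⊤)).op
        ((V ↘ Spec (.of k)).appTop ((Scheme.ΓSpecIso (.of k)).inv c)))) =
      ((Scheme.ΓSpecIso (.of k)).inv ≫
        (Spec (.of k)).presheaf.map (homOfLE (le_top : p ⁻¹ᵁ W ≤ ⊤)).op) :=
    funext fun c => congr($h c)
  rw [h2]
  exact ConcreteCategory.bijective_of_isIso _

/-- The morphisms from a line bundle to the structure sheaf of a `k`-point form a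
one-dimensional space. -/
lemma finrank_hom_pointSheaf {k : Type u} [Field k] {V : Scheme.{u}} [V.Over (Spec (.of k))]
    (p : Spec (.of k) ⟶ V) (hp : p ≫ (V ↘ Spec (.of k)) = 𝟙 _) {M : V.Modules}
    {U : V.Opens} (hU : p ⁻¹ᵁ U = ⊤)
    (e : M.restrict U.ι ≅ structureModule U) :
    Module.finrank k (M ⟶ pointSheaf p) = 1 := by
  obtain ⟨f₀, hf₀⟩ := exists_hom_pointSheaf_ne_zero p hU e
  refine finrank_eq_one f₀ hf₀ fun f => ?_
  have hW : p ⁻¹ᵁ (U.ι ''ᵁ ⊤) = ⊤ := by rw [Scheme.Opens.ι_image_top, hU]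
  let ev (f : M ⟶ pointSheaf p) : Γ(Spec (.of k), p ⁻¹ᵁ (U.ι ''ᵁ ⊤)) :=
    f.app (U.ι ''ᵁ ⊤) (generator e ⊤)
  have hev : ev f₀ ≠ 0 := fun h => hf₀ (eq_zero_of_app_generator p e f₀ ⊤ hW h)
  obtain ⟨a, ha⟩ := (bijective_app_of_comp_eq_id p hp hW).2 (ev f₀)
  obtain ⟨b, hb⟩ := (bijective_app_of_comp_eq_id p hp hW).2 (ev f)
  have ha0 : a ≠ 0 := by
    rintro rfl
    exact hev (by simpa using ha.symm)
  -- The ratio of the values of `f` and `f₀` on the generator.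
  refine ⟨b / a, ?_⟩
  rw [← sub_eq_zero]
  refine eq_zero_of_app_generator p e _ ⊤ hW ?_
  let s : Γ(M, U.ι ''ᵁ ⊤) := (M.restrictAppIso U.ι ⊤).hom (generator e ⊤)
  suffices h : ((b / a) • f₀).app (U.ι ''ᵁ ⊤) s = f.app (U.ι ''ᵁ ⊤) s from sub_eq_zero.mpr h
  rw [smul_app]
  change p.app (U.ι ''ᵁ ⊤) (V.presheaf.map (homOfLE (le_top : (U.ι ''ᵁ ⊤) ≤ ⊤)).op
    ((V ↘ Spec (.of k)).appTop ((Scheme.ΓSpecIso (.of k)).inv (b / a)))) * ev f₀ = ev f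
  rw [← ha, ← hb]
  dsimp only
  rw [← map_mul, ← map_mul, ← map_mul, ← map_mul, div_mul_cancel₀ b ha0]

/-! ### Global generation at a point. -/

/-- If `ℋom(M, N)` is globally generated, then some morphism `M ⟶ N` acts nontrivially on
morphisms to the structure sheaf of a point at which both are trivial. -/
lemma HomGloballyGenerated.exists_comp_ne_zero {k : Type u} [Field k] (p : Spec (.of k) ⟶ X)
    {M N : X.Modules} (h : M.HomGloballyGenerated N) {U : X.Opens} (hU : p ⁻¹ᵁ U = ⊤)
    (eM : M.restrict U.ι ≅ structureModule U) (eN : N.restrict U.ι ≅ structureModule U) :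
    ∃ (φ : M ⟶ N) (f : N ⟶ pointSheaf p), φ ≫ f ≠ 0 := by
  obtain ⟨f, hf⟩ := exists_hom_pointSheaf_ne_zero p hU eN
  by_contra! hφ
  have x : Spec (.of k) := default
  have hx : p x ∈ U := (hU ▸ trivial : x ∈ p ⁻¹ᵁ U)
  -- Global generation is applied to the local isomorphism matching the generators of `M` and `N`.
  obtain ⟨W, hxW, r, c, φ, hψ⟩ := h U (eM.hom ≫ eN.inv) ⟨p x, hx⟩
  have hW : p ⁻¹ᵁ (U.ι ''ᵁ W) = ⊤ := by
    refine top_le_iff.mp fun y _ => ?_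
    rw [Subsingleton.elim y x]
    exact ⟨_, hxW, rfl⟩
  refine hf (eq_zero_of_app_generator p eN f W hW ?_)
  have hgen : (eM.hom ≫ eN.inv).app W (generator eM W) = generator eN W := by
    have h1 := congr($((congrArg (fun f => Hom.app f W) eM.inv_hom_id)) (1 : Γ(U, W)))
    exact congrArg (eN.inv.app W) h1
  rw [← hgen, hψ W le_rfl, map_sum]
  refine Finset.sum_eq_zero fun l _ => ?_
  rw [Hom.app_smul]
  have h0 : (restrictFunctor U.ι).map (φ l) ≫ (restrictFunctor U.ι).map f = 0 := by
    rw [← Functor.map_comp, hφ, Functor.map_zero]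
  have h1 : ((restrictFunctor U.ι).map f).app W (((restrictFunctor U.ι).map (φ l)).app W
      (generator eM W)) = 0 := congr($((congrArg (fun f => Hom.app f W) h0)) (generator eM W))
  rw [h1, smul_zero]

lemma IsLineBundle.exists_trivialization {k : Type u} [Field k] {M : X.Modules}
    (hM : M.IsLineBundle) (p : Spec (.of k) ⟶ X) :
    ∃ U : X.Opens, p ⁻¹ᵁ U = ⊤ ∧ Nonempty (M.restrict U.ι ≅ structureModule U) := by
  obtain ⟨U, hU, e⟩ := hM (p default)
  refine ⟨U, top_le_iff.mp fun y _ => ?_, e⟩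
  rw [Subsingleton.elim y default]
  exact hU

end AlgebraicGeometry.Scheme.Modules

theorem proposition2 {k : Type u} [Field k] [IsAlgClosed k]
    {V : Scheme.{u}} [V.Over (Spec (.of k))] {n : ℕ}
    (E : Fin n → V.Modules) (hE : ∀ i, (E i).IsLineBundle)
    (Q : QuiverWithRelations.{w} k n) (Φ : PathAlgebraIso Q E)
    (m : Fin n → Fin n → ℕ)
    (hm : ∀ i j, m i j ≠ 0 → (E i).HomGloballyGenerated (E j)) :
    Φ.IsGood (characterOf m) := by
  intro p hp
  refine (Φ.tautological p).isSemistable_characterOf (fun i => ?_) m fun i j hij => ?_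
  · obtain ⟨U, hU, ⟨e⟩⟩ := (hE i).exists_trivialization p
    exact Scheme.Modules.finrank_hom_pointSheaf p hp hU e
  · obtain ⟨U, hU, ⟨e⟩⟩ := (hE i).exists_trivialization p
    obtain ⟨U', hU', ⟨e'⟩⟩ := (hE j).exists_trivialization p
    -- Both bundles must be trivial on the same open set to be compared.
    obtain ⟨d⟩ := Scheme.Modules.nonempty_restrict_iso_unit_of_le (inf_le_left : U ⊓ U' ≤ U) e
    obtain ⟨d'⟩ := Scheme.Modules.nonempty_restrict_iso_unit_of_le (inf_le_right : U ⊓ U' ≤ U') e'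
    obtain ⟨φ, f, hφ⟩ := (hm i j hij).exists_comp_ne_zero p (U := U ⊓ U')
      (by rw [Scheme.Hom.preimage_inf, hU, hU', inf_top_eq]) d d'
    refine ⟨(Φ.equiv j i).symm φ, fun h => hφ ?_⟩
    have h' := LinearMap.congr_fun h f
    change Φ.equiv j i ((Φ.equiv j i).symm φ) ≫ f = 0 at h'
    rwa [LinearEquiv.apply_symm_apply] at h'
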